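/- Let $T^n=\mathbb R^n/\mathbb Z^n$, let $\pi\colon\mathbb R^n\to T^n$ be the quotient map, and for $p_0,\dots,p_k\in\mathbb R^n$ let $[p_0,\dots,p_k]$ be the singular simplex $\sum_j\lambda_je_j\mapsto\pi(\sum_j\lambda_jp_j)$ of $T^n$. Let $C_k(X)$ denote the integral singular $k$-chains of a space $X$, with the $\ell^1$-norm $\|\sum_i a_i\sigma_i\|_1=\sum_i|a_i|$ (reduced sums). For a boundary $b\in C_k(X)$, the integral filling norm is $$\|b\|_{\mathrm{fill}}=\min\{\|z\|_1 : z\in C_{k+1}(X),\ \partial z=b\}.$$ For $v\in\mathbb Z^n$ let $h_v\colon T^n\times[0,1]\to T^n$ be the homotopy induced by $(x,t)\mapsto x+tv$. The associated prism operator $\mathcal P_v\colon C_k(T^n)\to C_{k+1}(T^n)$ sends a singular simplex $\sigma\colon\Delta^k\to T^n$ to the image, under $h_v\circ(\sigma\times\mathrm{id})$, of the chain $$\sum_{i=0}^{k}(-1)^i\,\big\langle (e_0,0),\dots,(e_{k-i},0),(e_{k-i},1),\dots,(e_k,1)\big\rangle$$ of $\Delta^k\times[0,1]$, where $\langle\cdots\rangle$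 is the straight (affine) simplex with the given vertices. For $v_1,v_2,\dots\in\mathbb Z^n$, the parallelogram-like cycles are defined by $P(v_1)=[0,v_1]$ and $P(v_1,\dots,v_k)=\mathcal P_{v_k}(P(v_1,\dots,v_{k-1}))\in C_k(T^n)$ for $k>1$. For $a_1,\dots,a_n\in\mathbb Z$, the rectangle-like cycle is $R(a_1,\dots,a_n)=P(a_1e_1,\dots,a_ne_n)\in C_n(T^n)$, where $e_1,\dots,e_n$ is the canonical basis of $\mathbb Z^n$. **Proposition.** For every integer $n\ge1$ there is a constant $K_n>0$ such that for all $v_1,\dots,v_n\in\mathbb Z^n$, if $A$ is the matrix with columns $v_1,\dots,v_n$ and $\|A\|_\infty$ is the maximum of the absolute values of its entries, then the chain $P(v_1,\dots,v_n)-R(\det A,1,\dots,1)$ is a boundary in $T^n$ and $$\|P(v_1,\dots,v_n)-R(\det A,1,\dots,1)\|_{\mathrm{fill}}\le K_n\log_2\|A\|_\infty+K_n,$$ where $\log_2 0$ is read as $0$ when $A=0$. -/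

import Mathlib

open scoped Matrix.Norms.Elementwise

noncomputable section

namespace TorusFilling

/-! ### Integral singular chains, the `ℓ¹`-norm and the integral filling norm -/

/-- The standard topological `k`-simplex, with vertices indexed by `0, …, k`. -/
abbrev Simplex (k : ℕ) : Type := stdSimplex ℝ (Fin (k + 1))

/-- Integral singular `k`-chains of `X`: the free abelian group on the singular `k`-simplices. -/
abbrev SingularChain (X : Type*) [TopologicalSpace X] (k : ℕ) : Type _ :=
  C(Simplex k, X) →₀ ℤ

/-- The `i`-th face inclusion `Δ^k → Δ^(k+1)`, the affine map missing the `i`-th vertex. -/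
def faceMap (k : ℕ) (i : Fin (k + 2)) : C(Simplex k, Simplex (k + 1)) :=
  ⟨stdSimplex.map i.succAbove, stdSimplex.continuous_map _⟩

/-- The singular boundary operator `∂ : C_{k+1}(X) → C_k(X)`. -/
def boundary {X : Type*} [TopologicalSpace X] (k : ℕ) :
    SingularChain X (k + 1) →ₗ[ℤ] SingularChain X k :=
  Finsupp.linearCombination ℤ fun σ : C(Simplex (k + 1), X) =>
    ∑ i : Fin (k + 2), Finsupp.single (σ.comp (faceMap k i)) ((-1 : ℤ) ^ (i : ℕ))

/-- The group of singular `k`-boundaries of `X`. -/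
def boundaries (X : Type*) [TopologicalSpace X] (k : ℕ) : Submodule ℤ (SingularChain X k) :=
  LinearMap.range (boundary (X := X) k)

/-- The `ℓ¹`-norm of an integral chain. -/
def l1Norm {X : Type*} [TopologicalSpace X] {k : ℕ} (c : SingularChain X k) : ℕ :=
  c.sum fun _ a => a.natAbs

/-- The integral filling norm of a boundary: the least `ℓ¹`-norm of an integral chain bounding it.
(It is only meaningful on `boundaries X k`; elsewhere its value is `0`.) -/
def fillingNorm {X : Type*} [TopologicalSpace X] {k : ℕ} (b : SingularChain X k) : ℕ :=
  sInf {m : ℕ | ∃ z : SingularChain X (k + 1), boundary k z = b ∧ l1Norm z = m}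

/-- The chain map induced by a continuous map. -/
def pushforward {X Y : Type*} [TopologicalSpace X] [TopologicalSpace Y] (f : C(X, Y)) (k : ℕ) :
    SingularChain X k →ₗ[ℤ] SingularChain Y k :=
  Finsupp.linearCombination ℤ fun σ : C(Simplex k, X) => Finsupp.single (f.comp σ) (1 : ℤ)

/-! ### Straight simplices and the prism operator -/

/-- The straight simplex `∑ λ_j e_j ↦ ∑ λ_j p_j` in a real topological vector space. -/
def straightSimplex {E : Type*} [AddCommGroup E] [Module ℝ E] [TopologicalSpace E]
    [ContinuousAdd E] [ContinuousSMul ℝ E] {k : ℕ} (p : Fin (k + 1) → E) : C(Simplex k, E) where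
  toFun s := ∑ j, (s : Fin (k + 1) → ℝ) j • p j
  continuous_toFun := by
    refine continuous_finsetSum _ fun j _ => ?_
    exact ((continuous_apply j).comp continuous_subtype_val).smul continuous_const

theorem straightSimplex_mem {E : Type*} [AddCommGroup E] [Module ℝ E] [TopologicalSpace E]
    [ContinuousAdd E] [ContinuousSMul ℝ E] {k : ℕ} {p : Fin (k + 1) → E} {S : Set E}
    (hS : Convex ℝ S) (hp : ∀ j, p j ∈ S) (s : Simplex k) : straightSimplex p s ∈ S :=
  hS.sum_mem (fun j _ => s.2.1 j) s.2.2 fun j _ => hp j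

/-- The vertices of the `i`-th simplex in the triangulation of the prism `Δ^k × [0,1]`:
`(e_0,0), …, (e_{k-i},0), (e_{k-i},1), …, (e_k,1)`. -/
def prismVertex (k : ℕ) (i : Fin (k + 1)) (j : Fin (k + 2)) : (Fin (k + 1) → ℝ) × ℝ :=
  if h : (j : ℕ) ≤ k - i then (Pi.single ⟨j, by omega⟩ 1, 0)
  else (Pi.single ⟨j - 1, by omega⟩ 1, 1)

theorem prismVertex_mem (k : ℕ) (i : Fin (k + 1)) (j : Fin (k + 2)) :
    prismVertex k i j ∈ stdSimplex ℝ (Fin (k + 1)) ×ˢ Set.Icc (0 : ℝ) 1 := by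
  unfold prismVertex
  split_ifs
  · exact ⟨single_mem_stdSimplex ℝ _, by simp⟩
  · exact ⟨single_mem_stdSimplex ℝ _, by simp⟩

theorem straight_prismVertex_mem (k : ℕ) (i : Fin (k + 1)) (s : Simplex (k + 1)) :
    straightSimplex (prismVertex k i) s ∈ stdSimplex ℝ (Fin (k + 1)) ×ˢ Set.Icc (0 : ℝ) 1 :=
  straightSimplex_mem ((convex_stdSimplex ℝ _).prod (convex_Icc 0 1)) (prismVertex_mem k i) s

/-- The straight simplex with vertices `prismVertex k i`, as a singular simplex of
`Δ^k × [0,1]`. -/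
def prismSimplex (k : ℕ) (i : Fin (k + 1)) : C(Simplex (k + 1), Simplex k × unitInterval) where
  toFun s :=
    (⟨(straightSimplex (prismVertex k i) s).1, (straight_prismVertex_mem k i s).1⟩,
      ⟨(straightSimplex (prismVertex k i) s).2, (straight_prismVertex_mem k i s).2⟩)
  continuous_toFun := by
    refine Continuous.prodMk ?_ ?_
    · exact Continuous.subtype_mk (continuous_fst.comp (straightSimplex _).continuous) _
    · exact Continuous.subtype_mk (continuous_snd.comp (straightSimplex _).continuous) _

/-- The `(k+1)`-chain
`∑_i (-1)^i [(e_0,0), …, (e_{k-i},0), (e_{k-i},1), …, (e_k,1)]` of `Δ^k × [0,1]`. -/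
def prismChain (k : ℕ) : SingularChain (Simplex k × unitInterval) (k + 1) :=
  ∑ i : Fin (k + 1), Finsupp.single (prismSimplex k i) ((-1 : ℤ) ^ (i : ℕ))

/-- The prism operator `C_k(X) → C_{k+1}(Y)` of a homotopy `F : X × [0,1] → Y`, sending a singular
simplex `σ` to the push-forward of `prismChain k` under `F ∘ (σ × id)`. -/
def prismOperator {X Y : Type*} [TopologicalSpace X] [TopologicalSpace Y]
    (F : C(X × unitInterval, Y)) (k : ℕ) : SingularChain X k →ₗ[ℤ] SingularChain Y (k + 1) :=
  Finsupp.linearCombination ℤ fun σ : C(Simplex k, X) =>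
    pushforward (F.comp (σ.prodMap (ContinuousMap.id unitInterval))) (k + 1) (prismChain k)

/-! ### Parallelogram-like and rectangle-like cycles on the torus -/

/-- The quotient map `ℝ^n → T^n = ℝ^n / ℤ^n`. -/
def torusMk (n : ℕ) : C(Fin n → ℝ, UnitAddTorus (Fin n)) where
  toFun x i := (x i : UnitAddCircle)
  continuous_toFun :=
    continuous_pi fun i => (AddCircle.continuous_mk' 1).comp (continuous_apply i)

/-- An integer vector as a point of `ℝ^n`. -/
def intVec {n : ℕ} (v : Fin n → ℤ) : Fin n → ℝ := fun i => (v i : ℝ)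

/-- The projection `[p_0, …, p_k]` to `T^n` of the straight simplex of `ℝ^n` with vertices
`p_0, …, p_k`. -/
def torusSimplex {n k : ℕ} (p : Fin (k + 1) → Fin n → ℝ) : C(Simplex k, UnitAddTorus (Fin n)) :=
  (torusMk n).comp (straightSimplex p)

/-- The homotopy `h_v : T^n × [0,1] → T^n` from the identity to itself induced by
`(x, t) ↦ x + t v` on `ℝ^n`. -/
def translationHomotopy {n : ℕ} (v : Fin n → ℤ) :
    C(UnitAddTorus (Fin n) × unitInterval, UnitAddTorus (Fin n)) where
  toFun q := q.1 + torusMk n ((q.2 : ℝ) • intVec v)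
  continuous_toFun := by
    refine continuous_fst.add ((torusMk n).continuous.comp ?_)
    exact (continuous_subtype_val.comp continuous_snd).smul continuous_const

theorem translationHomotopy_mk {n : ℕ} (v : Fin n → ℤ) (x : Fin n → ℝ) (t : unitInterval) :
    translationHomotopy v (torusMk n x, t) = torusMk n (x + (t : ℝ) • intVec v) := rfl

/-- The parallelogram-like `k`-cycle of `T^n` generated by `v_1, …, v_k ∈ ℤ^n`: for `k = 1` it is
`[0, v_1]`, and the cycle of `v_1, …, v_{k+1}` is obtained from that of `v_1, …, v_k` by applying
the prism operator of `h_{v_{k+1}}`. (For `k = 0` we take the point `[0]`.) -/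
def parallelogram {n : ℕ} : (k : ℕ) → (Fin k → Fin n → ℤ) → SingularChain (UnitAddTorus (Fin n)) k
  | 0, _ => Finsupp.single (torusSimplex ![0]) 1
  | 1, v => Finsupp.single (torusSimplex ![0, intVec (v 0)]) 1
  | k + 2, v => prismOperator (translationHomotopy (v (Fin.last (k + 1)))) (k + 1)
      (parallelogram (k + 1) (Fin.init v))

/-- The rectangle-like cycle of `T^n` generated by `a_1 e_1, …, a_n e_n`. -/
def rectangle {n : ℕ} (a : Fin n → ℤ) : SingularChain (UnitAddTorus (Fin n)) n :=
  parallelogram n fun i => Pi.single i (a i)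

end TorusFilling

end

/-! A word `[g₁, …, gₖ]` in `ℤⁿ` stands for the simplex of the torus whose vertices are its partial
sums. In this dictionary the singular boundary becomes the bar differential, and the prism operator
of `v` becomes signed insertion of the letter `v`, so a parallelogram-like cycle is the iterated
insertion of its generators into the empty word. Insertions anticommute exactly and commute with the
differential. Hence the cycle is strictly alternating in its generators. It is also additive in each
generator up to a boundary with a filling of bounded norm: inserting the other letters into `[x, y]`
fills the defect (`quasiAdditive_parallelogram_cons`).

The rest is formal. A map alternating and additive up to bounded error can be expanded as in the
Leibniz formula for the determinant; the danger is that pulling out a scalar `a` by repeated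
addition costs about `|a|`. Scalars are therefore only moved between slots: `B(a x, y) ≈ B(x, a y)`
costs `O(log |a|)`, by processing the binary digits of `a` (`QuasiBiadditive.nsmul`). Terms with a
repeated basis vector vanish up to `O(log)` by alternation (`QuasiBiadditive.zsmul_self`). In the
other terms all scalars are collected on one basis vector, where the signed products add up to the
determinant (`exists_near_det`). The number of terms depends on `n` only. -/

noncomputable section

namespace TorusFilling

/-! ### The bar complex of an abelian group and insertion of a letter -/

/-- Integral chains of the bar complex: integral combinations of words. -/
abbrev BarChain (G : Type*) : Type _ := List G →₀ ℤ

namespace BarChain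

variable {G : Type*}

/-- Prepend a letter. -/
def cons (g : G) : BarChain G →ₗ[ℤ] BarChain G := Finsupp.lmapDomain ℤ ℤ (List.cons g)

@[simp] theorem cons_single (g : G) (w : List G) (a : ℤ) :
    cons g (Finsupp.single w a) = Finsupp.single (g :: w) a := by
  simp [cons]

theorem hom_ext_cons {N : Type*} [AddCommGroup N] {f f' : BarChain G →ₗ[ℤ] N}
    (nil : f (Finsupp.single [] 1) = f' (Finsupp.single [] 1))
    (step : ∀ g w, f (Finsupp.single w 1) = f' (Finsupp.single w 1) →
      f (cons g (Finsupp.single w 1)) = f' (cons g (Finsupp.single w 1))) : f = f' := by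
  refine Finsupp.lhom_ext' fun w => LinearMap.ext_ring ?_
  simp only [LinearMap.comp_apply, Finsupp.lsingle_apply]
  induction w with
  | nil => exact nil
  | cons g w ih => simpa using step g w ih

/-- Multiply a word by the sign of its length. -/
def parity : BarChain G →ₗ[ℤ] BarChain G :=
  Finsupp.linearCombination ℤ fun w => Finsupp.single w ((-1) ^ w.length)

theorem parity_single (w : List G) :
    parity (Finsupp.single w 1) = Finsupp.single w ((-1) ^ w.length) := by
  simp [parity]

theorem parity_cons (g : G) (x : BarChain G) : parity (cons g x) = -cons g (parity x) := by
  have : parity ∘ₗ cons g = -(cons g ∘ₗ parity) := by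
    refine Finsupp.lhom_ext' fun w => LinearMap.ext_ring ?_
    simp [parity_single, pow_succ, ← Finsupp.single_neg]
  exact LinearMap.congr_fun this x

theorem parity_parity (x : BarChain G) : parity (parity x) = x := by
  have : parity ∘ₗ parity = (LinearMap.id : BarChain G →ₗ[ℤ] _) := by
    refine Finsupp.lhom_ext' fun w => LinearMap.ext_ring ?_
    simp only [LinearMap.comp_apply, Finsupp.lsingle_apply, parity_single]
    rw [← mul_one ((-1 : ℤ) ^ w.length), ← smul_eq_mul, ← Finsupp.smul_single, map_smul,
      parity_single, Finsupp.smul_single, smul_eq_mul, ← mul_pow]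
    simp
  exact LinearMap.congr_fun this x

/-- The signed sum of all words obtained by inserting `v` into a given word. -/
def insertWord (v : G) : List G → BarChain G
  | [] => Finsupp.single [v] 1
  | g :: w => cons g (insertWord v w) + Finsupp.single (v :: g :: w) ((-1) ^ (w.length + 1))

/-- Signed insertion of a letter. -/
def insert (v : G) : BarChain G →ₗ[ℤ] BarChain G := Finsupp.linearCombination ℤ (insertWord v)

theorem insert_single (v : G) (w : List G) :
    insert v (Finsupp.single w 1) = insertWord v w := by
  simp [insert]

theorem insert_nil (v : G) :
    insert v (Finsupp.single [] 1) = cons v (Finsupp.single [] 1) := by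
  simp [insert_single, insertWord]

theorem insert_cons (v g : G) (x : BarChain G) :
    insert v (cons g x) = cons g (insert v x) - cons v (cons g (parity x)) := by
  have : insert v ∘ₗ cons g = cons g ∘ₗ insert v - cons v ∘ₗ cons g ∘ₗ parity := by
    refine Finsupp.lhom_ext' fun w => LinearMap.ext_ring ?_
    simp [insert_single, insertWord, parity_single, pow_succ, ← Finsupp.single_neg,
      sub_eq_add_neg]
  exact LinearMap.congr_fun this x

theorem parity_insert (v : G) (x : BarChain G) :
    parity (insert v x) = -insert v (parity x) := by
  have : parity ∘ₗ insert v = -(insert v ∘ₗ parity) := by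
    refine hom_ext_cons ?_ fun g w ih => ?_
    · simp [parity_single, insert_single, insertWord, ← Finsupp.single_neg]
    · simp only [LinearMap.comp_apply, LinearMap.neg_apply] at ih ⊢
      simp only [insert_cons, parity_cons, map_sub, map_neg, ih]
      abel
  exact LinearMap.congr_fun this x

/-- The sign of an insertion counts the letters to its right. A word containing both new letters
arises once in each order, and the left one counts the right one in exactly one of the orders; so
the signs are opposite. -/
theorem insert_insert (v w : G) (x : BarChain G) :
    insert v (insert w x) = -insert w (insert v x) := by
  have : insert v ∘ₗ insert w = -(insert w ∘ₗ insert v) := by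
    refine hom_ext_cons ?_ fun g w ih => ?_
    · simp only [LinearMap.comp_apply, LinearMap.neg_apply, insert_nil, insert_cons,
        parity_single, List.length_nil, pow_zero]
      abel
    · simp only [LinearMap.comp_apply, LinearMap.neg_apply] at ih ⊢
      simp only [insert_cons, parity_cons, parity_insert, map_sub, map_neg, ih, parity_parity]
      abel
  exact LinearMap.congr_fun this x

/-- Remove the first letter of each word. -/
def tail : BarChain G →ₗ[ℤ] BarChain G :=
  Finsupp.linearCombination ℤ fun w => match w with
    | [] => 0
    | _ :: w => Finsupp.single w 1

theorem tail_nil : tail (Finsupp.single ([] : List G) 1) = 0 := by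
  simp [tail]

theorem tail_cons (g : G) (x : BarChain G) : tail (cons g x) = x := by
  have : tail ∘ₗ cons g = LinearMap.id := by
    refine Finsupp.lhom_ext' fun w => LinearMap.ext_ring ?_
    simp [tail]
  exact LinearMap.congr_fun this x

/-- The extra term comes from inserting `v` in front and deleting it again. -/
theorem tail_insert (v : G) (x : BarChain G) :
    tail (insert v x) = insert v (tail x) + parity x := by
  have : tail ∘ₗ insert v = insert v ∘ₗ tail + parity := by
    refine hom_ext_cons ?_ fun g w _ => ?_
    · simp only [LinearMap.comp_apply, LinearMap.add_apply, insert_nil, tail_nil, tail_cons]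
      simp [parity_single]
    · simp only [LinearMap.comp_apply, LinearMap.add_apply, insert_cons, tail_cons, map_sub,
        parity_cons]
      abel
  exact LinearMap.congr_fun this x

/-! ### Iterated insertion as an alternating map -/

/-- Insertion is not additive in the letter, so it is extended linearly to the free group on the
letters, as the exterior algebra requires. Anticommutation then gives `2 (s u)² = 0`, and integral
chains have no torsion. -/
theorem linearCombination_insert_mul_self (u : G →₀ ℤ) :
    Finsupp.linearCombination ℤ (M := Module.End ℤ (BarChain G)) insert u *
      Finsupp.linearCombination ℤ (M := Module.End ℤ (BarChain G)) insert u = 0 := by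
  set s := Finsupp.linearCombination ℤ (M := Module.End ℤ (BarChain G)) insert
  have h : (LinearMap.mul ℤ (Module.End ℤ (BarChain G))).compl₁₂ s s =
      -((LinearMap.mul ℤ (Module.End ℤ (BarChain G))).compl₁₂ s s).flip := by
    refine Finsupp.lhom_ext' fun v => LinearMap.ext_ring ?_
    refine Finsupp.lhom_ext' fun w => LinearMap.ext_ring ?_
    refine LinearMap.ext fun x => ?_
    simp [s, insert_insert v w]
  have h' : s u * s u = -(s u * s u) := by
    simpa using LinearMap.congr_fun (LinearMap.congr_fun h u) u
  ext x y
  have := DFunLike.congr_fun (LinearMap.congr_fun h' (Finsupp.single x 1)) y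
  simp at this
  simp
  omega

/-- Iterated insertion of letters, `v ↦ insert (v (n - 1)) ∘ ⋯ ∘ insert (v 0)`, extended to formal
combinations of letters. -/
def iterInsert (G : Type*) (n : ℕ) : (G →₀ ℤ) [⋀^Fin n]→ₗ[ℤ] Module.End ℤ (BarChain G) :=
  -- The opposite algebra reverses the product, so that the letter of index `0` is inserted first.
  ((MulOpposite.opLinearEquiv ℤ).symm.toLinearMap ∘ₗ
    (ExteriorAlgebra.lift ℤ ⟨(MulOpposite.opLinearEquiv ℤ).toLinearMap ∘ₗ
      Finsupp.linearCombination ℤ (M := Module.End ℤ (BarChain G)) insert, fun u => by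
        simp [← MulOpposite.op_mul, linearCombination_insert_mul_self]⟩).toLinearMap).compAlternatingMap
    (ExteriorAlgebra.ιMulti ℤ n)

theorem iterInsert_zero (v : Fin 0 → G →₀ ℤ) : iterInsert G 0 v = 1 := by
  simp [iterInsert]

theorem iterInsert_succ {n : ℕ} (v : Fin (n + 1) → G →₀ ℤ) :
    iterInsert G (n + 1) v = iterInsert G n (Fin.tail v) *
      Finsupp.linearCombination ℤ insert (v 0) := by
  simp [iterInsert, ExteriorAlgebra.ιMulti_succ_apply, Matrix.vecTail, Fin.tail_def,
    Function.comp_def]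

theorem iterInsert_succ_last {n : ℕ} (v : Fin (n + 1) → G →₀ ℤ) :
    iterInsert G (n + 1) v = Finsupp.linearCombination ℤ insert (v (Fin.last n)) *
      iterInsert G n (Fin.init v) := by
  simp [iterInsert, ExteriorAlgebra.ιMulti_apply, List.ofFn_succ', Fin.init_def,
    -ExteriorAlgebra.ιMulti_succ_apply, -List.ofFn_succ]

/-! ### The bar differential -/

variable [AddCommGroup G]

/-- Add an element to the first letter of a word. -/
def mergeHead (g : G) : List G → List G
  | [] => []
  | h :: w => (g + h) :: w

/-- Add an element to the first letter of each word. -/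
def merge (g : G) : BarChain G →ₗ[ℤ] BarChain G := Finsupp.lmapDomain ℤ ℤ (mergeHead g)

@[simp] theorem merge_single (g : G) (w : List G) (a : ℤ) :
    merge g (Finsupp.single w a) = Finsupp.single (mergeHead g w) a := by
  simp [merge]

theorem merge_cons (g h : G) (x : BarChain G) : merge g (cons h x) = cons (g + h) x := by
  have : merge g ∘ₗ cons h = cons (g + h) := by
    refine Finsupp.lhom_ext' fun w => LinearMap.ext_ring ?_
    simp [mergeHead]
  exact LinearMap.congr_fun this x

/-- All faces of a word but the first one. -/
def innerWord : List G → BarChain G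
  | [] => 0
  | g :: w => -Finsupp.single (mergeHead g w) 1 - cons g (innerWord w)

/-- All terms of the bar differential but the first one. -/
def inner : BarChain G →ₗ[ℤ] BarChain G := Finsupp.linearCombination ℤ innerWord

theorem inner_single (w : List G) : inner (Finsupp.single w 1) = innerWord w := by
  simp [inner]

theorem inner_cons (g : G) (x : BarChain G) :
    inner (cons g x) = -merge g x - cons g (inner x) := by
  have : inner ∘ₗ cons g = -merge g - cons g ∘ₗ inner := by
    refine Finsupp.lhom_ext' fun w => LinearMap.ext_ring ?_
    simp [inner_single, innerWord]
  exact LinearMap.congr_fun this x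

theorem parity_merge (g : G) (x : BarChain G) : parity (merge g x) = merge g (parity x) := by
  have : parity ∘ₗ merge g = merge g ∘ₗ parity := by
    refine Finsupp.lhom_ext' fun w => LinearMap.ext_ring ?_
    cases w <;> simp [parity_single, mergeHead]
  exact LinearMap.congr_fun this x

theorem parity_inner (x : BarChain G) : parity (inner x) = -inner (parity x) := by
  have : parity ∘ₗ inner = -(inner ∘ₗ (parity : BarChain G →ₗ[ℤ] _)) := by
    refine hom_ext_cons ?_ fun g w ih => ?_
    · simp [inner_single, innerWord, parity_single]
    · simp only [LinearMap.comp_apply, LinearMap.neg_apply] at ih ⊢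
      simp only [inner_cons, parity_cons, map_sub, map_neg, ih, parity_merge]
      abel
  exact LinearMap.congr_fun this x

theorem merge_insert (g v : G) (x : BarChain G) :
    merge g (insert v x) =
      insert v (merge g x) - cons v (merge g (parity x)) + cons (v + g) (parity x) := by
  have : merge g ∘ₗ insert v =
      insert v ∘ₗ merge g - cons v ∘ₗ merge g ∘ₗ parity + cons (v + g) ∘ₗ parity := by
    refine hom_ext_cons ?_ fun h w _ => ?_
    · simp [parity_single, insert_single, insertWord, mergeHead, add_comm]
    · simp only [LinearMap.comp_apply, LinearMap.sub_apply, LinearMap.add_apply, insert_cons,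
        merge_cons, map_sub, parity_cons, map_neg, add_comm]
      abel
  exact LinearMap.congr_fun this x

/-- Merging `v` with a neighbour `g` gives `v + g` or `g + v` according to the side of `g` on which
`v` was inserted; as `G` is commutative, these terms cancel. What survives is `v` inserted at the
end and deleted by the last face. It cancels the extra term of `tail_insert`, which is why insertion
commutes with the whole differential: the homotopy starts and ends at the identity. -/
theorem inner_insert (v : G) (x : BarChain G) :
    inner (insert v x) = insert v (inner x) - parity x := by
  have : inner ∘ₗ insert v = insert v ∘ₗ inner - parity := by
    refine hom_ext_cons ?_ fun g w ih => ?_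
    · simp [insert_single, insertWord, inner_single, innerWord, parity_single,
        mergeHead]
    · simp only [LinearMap.comp_apply, LinearMap.sub_apply] at ih ⊢
      simp only [insert_cons, inner_cons, parity_cons, parity_inner, merge_insert, merge_cons,
        map_sub, map_neg, ih]
      abel
  exact LinearMap.congr_fun this x

/-- The bar differential. -/
def differential : BarChain G →ₗ[ℤ] BarChain G := tail + inner

theorem differential_insert (v : G) (x : BarChain G) :
    differential (insert v x) = insert v (differential x) := by
  simp only [differential, LinearMap.add_apply, tail_insert, inner_insert, map_add]
  abel

end BarChain

/-! ### The `ℓ¹`-norm of integral combinations -/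

section L1

variable {α β : Type*}

/-- The `ℓ¹`-norm on a free abelian group. -/
def l1 (c : α →₀ ℤ) : ℕ := c.sum fun _ a => a.natAbs

@[simp] theorem l1_zero : l1 (0 : α →₀ ℤ) = 0 := rfl

theorem l1_single (a : α) (m : ℤ) : l1 (Finsupp.single a m) = m.natAbs := by
  simp [l1]

theorem l1_neg (c : α →₀ ℤ) : l1 (-c) = l1 c := by
  simp [l1, Finsupp.sum_neg_index]

theorem l1_add_le (c d : α →₀ ℤ) : l1 (c + d) ≤ l1 c + l1 d := by
  classical
  have h (e : α →₀ ℤ) (he : e.support ⊆ c.support ∪ d.support) :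
      l1 e = ∑ a ∈ c.support ∪ d.support, (e a).natAbs :=
    Finsupp.sum_of_support_subset _ he _ (by simp)
  rw [h _ Finsupp.support_add, h c Finset.subset_union_left, h d Finset.subset_union_right,
    ← Finset.sum_add_distrib]
  exact Finset.sum_le_sum fun a _ => Int.natAbs_add_le _ _

theorem l1_sum_le {ι : Type*} (s : Finset ι) (f : ι → α →₀ ℤ) :
    l1 (∑ i ∈ s, f i) ≤ ∑ i ∈ s, l1 (f i) :=
  Finset.le_sum_of_subadditive l1 l1_zero.le l1_add_le s f

theorem l1_smul (m : ℤ) (c : α →₀ ℤ) : l1 (m • c) = m.natAbs * l1 c := by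
  simp [l1, Finsupp.sum, Finset.mul_sum, Int.natAbs_mul]
  rcases eq_or_ne m 0 with rfl | hm
  · simp
  · rw [Finsupp.support_smul_eq hm]

theorem l1_map_le (f : (α →₀ ℤ) →ₗ[ℤ] (β →₀ ℤ)) {s : Set α} {N : ℕ}
    (h : ∀ a ∈ s, l1 (f (Finsupp.single a 1)) ≤ N) {c : α →₀ ℤ}
    (hc : c ∈ Finsupp.supported ℤ ℤ s) : l1 (f c) ≤ N * l1 c := by
  have hf : f c = ∑ a ∈ c.support, c a • f (Finsupp.single a 1) := by
    conv_lhs => rw [← Finsupp.sum_single c, Finsupp.sum, map_sum]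
    exact Finset.sum_congr rfl fun a _ => by rw [← map_smul, Finsupp.smul_single_one]
  rw [hf, show N * l1 c = ∑ a ∈ c.support, N * (c a).natAbs from Finset.mul_sum _ _ _]
  refine (l1_sum_le _ _).trans (Finset.sum_le_sum fun a ha => ?_)
  rw [l1_smul, mul_comm]
  exact Nat.mul_le_mul_right _ (h a (hc ha))

end L1

/-! ### Homogeneous bar chains -/

namespace BarChain

variable {G : Type*}

/-- Combinations of words of length `k`. -/
def homogeneous (G : Type*) (k : ℕ) : Submodule ℤ (BarChain G) :=
  Finsupp.supported ℤ ℤ {w | w.length = k}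

theorem single_mem_homogeneous {w : List G} {k : ℕ} (hw : w.length = k) (a : ℤ) :
    Finsupp.single w a ∈ homogeneous G k :=
  Finsupp.single_mem_supported ℤ a hw

theorem homogeneous_le {k : ℕ} {S : Submodule ℤ (BarChain G)}
    (h : ∀ w : List G, w.length = k → Finsupp.single w 1 ∈ S) : homogeneous G k ≤ S := by
  rw [homogeneous, Finsupp.supported_eq_span_single, Submodule.span_le]
  rintro _ ⟨w, hw, rfl⟩
  exact h w hw

theorem eq_on_homogeneous {N : Type*} [AddCommGroup N] {k : ℕ} {f f' : BarChain G →ₗ[ℤ] N}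
    (h : ∀ w : List G, w.length = k → f (Finsupp.single w 1) = f' (Finsupp.single w 1))
    {x : BarChain G} (hx : x ∈ homogeneous G k) : f x = f' x :=
  homogeneous_le (S := LinearMap.eqLocus f f') h hx

theorem insertWord_eq_sum (v : G) (w : List G) :
    insertWord v w = ∑ i ∈ Finset.range (w.length + 1),
      Finsupp.single (w.insertIdx (w.length - i) v) ((-1) ^ i) := by
  induction w with
  | nil => simp [insertWord]
  | cons g w ih =>
    rw [insertWord, ih, List.length_cons, Finset.sum_range_succ _ (w.length + 1), map_sum]
    congr 1
    · refine Finset.sum_congr rfl fun i hi => ?_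
      rw [Finset.mem_range] at hi
      rw [cons_single, Nat.succ_sub (by omega), List.insertIdx_succ_cons]
    · simp

theorem insert_mem (v : G) {k : ℕ} {x : BarChain G} (hx : x ∈ homogeneous G k) :
    insert v x ∈ homogeneous G (k + 1) := by
  refine homogeneous_le (S := (homogeneous G (k + 1)).comap (insert v)) (fun w hw => ?_) hx
  rw [Submodule.mem_comap, insert_single, insertWord_eq_sum]
  refine Submodule.sum_mem _ fun i _ => single_mem_homogeneous ?_ _
  rw [List.length_insertIdx_of_le_length (by omega), hw]

theorem l1_insert_le (v : G) {k : ℕ} {x : BarChain G} (hx : x ∈ homogeneous G k) :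
    l1 (insert v x) ≤ (k + 1) * l1 x := by
  refine l1_map_le _ (fun w hw => ?_) hx
  rw [insert_single, insertWord_eq_sum, hw.out]
  refine (l1_sum_le _ _).trans (le_of_eq ?_)
  simp [l1_single]

theorem iterInsert_succ_last_single {n : ℕ} (v : Fin (n + 1) → G) (x : BarChain G) :
    iterInsert G (n + 1) (fun i => Finsupp.single (v i) 1) x = insert (v (Fin.last n))
      (iterInsert G n (fun i => Finsupp.single (Fin.init v i) 1) x) := by
  rw [iterInsert_succ_last, Module.End.mul_apply, Finsupp.linearCombination_single, one_smul]
  rfl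

theorem iterInsert_mem {n k : ℕ} (v : Fin n → G) {x : BarChain G} (hx : x ∈ homogeneous G k) :
    iterInsert G n (fun i => Finsupp.single (v i) 1) x ∈ homogeneous G (k + n) := by
  induction n with
  | zero => simpa [iterInsert_zero] using hx
  | succ n ih =>
    rw [iterInsert_succ_last_single]
    exact insert_mem (v (Fin.last n)) (ih (Fin.init v))

/-- A letter can be inserted into a word of length `m` in `m + 1` places. The factor `k!` in the
resulting quotient `(k + n)! / k!` is not divided out. -/
theorem l1_iterInsert_le {n k : ℕ} (v : Fin n → G) {x : BarChain G}
    (hx : x ∈ homogeneous G k) :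
    l1 (iterInsert G n (fun i => Finsupp.single (v i) 1) x) ≤ (k + n).factorial * l1 x := by
  induction n with
  | zero => simpa [iterInsert_zero] using Nat.le_mul_of_pos_left _ (Nat.factorial_pos k)
  | succ n ih =>
    rw [iterInsert_succ_last_single]
    refine (l1_insert_le (v (Fin.last n)) (iterInsert_mem (Fin.init v) hx)).trans ?_
    rw [← add_assoc, Nat.factorial_succ, mul_assoc]
    exact Nat.mul_le_mul_left _ (ih _)

variable [AddCommGroup G]

theorem differential_iterInsert {n : ℕ} (v : Fin n → G) (x : BarChain G) :
    differential (iterInsert G n (fun i => Finsupp.single (v i) 1) x) =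
      iterInsert G n (fun i => Finsupp.single (v i) 1) (differential x) := by
  induction n with
  | zero => simp [iterInsert_zero]
  | succ n ih =>
    rw [iterInsert_succ_last_single, iterInsert_succ_last_single, differential_insert, ih]

theorem differential_pair (g h : G) :
    differential (Finsupp.single [g, h] 1) =
      Finsupp.single [h] 1 - Finsupp.single [g + h] 1 + Finsupp.single [g] 1 := by
  simp [differential, tail, inner_single, innerWord, mergeHead]
  abel

/-- Merge the letter in position `i` with the next one; if there is no next one, delete it. -/
def mergeAt : ℕ → List G → List G
  | _, [] => []
  | 0, g :: w => mergeHead g w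
  | i + 1, g :: w => g :: mergeAt i w

theorem innerWord_eq_sum (w : List G) :
    innerWord w = ∑ i ∈ Finset.range w.length,
      Finsupp.single (mergeAt i w) ((-1) ^ (i + 1)) := by
  induction w with
  | nil => simp [innerWord]
  | cons g w ih =>
    rw [innerWord, ih, List.length_cons, Finset.sum_range_succ', map_sum, sub_eq_neg_add]
    simp [mergeAt, pow_succ, ← Finset.sum_neg_distrib, ← Finsupp.single_neg]

/-- In terms of partial sums, `mergeAt i` skips the vertex `i + 1`, also when it deletes the last
letter. -/
theorem sum_take_mergeAt (w : List G) (i j : ℕ) (hj : j < w.length) :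
    ((mergeAt i w).take j).sum =
      if j ≤ i then (w.take j).sum else (w.take (j + 1)).sum := by
  induction w generalizing i j with
  | nil => simp at hj
  | cons g w ih =>
    rcases j with _ | j
    · simp
    rcases i with _ | i
    · rcases w with _ | ⟨h, w⟩
      · simp at hj
      · simp [mergeAt, mergeHead, add_assoc]
    · have := ih i j (by simpa using hj)
      simp only [mergeAt, List.take_succ_cons, List.sum_cons, this, Nat.succ_le_succ_iff]
      split_ifs <;> rfl

/-- Insertion at `i` repeats vertex `i` and translates everything after the first copy by `v`, like
a simplex of the prism. -/
theorem sum_take_insertIdx (v : G) (w : List G) (i j : ℕ) (hi : i ≤ w.length) :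
    ((w.insertIdx i v).take j).sum =
      if j ≤ i then (w.take j).sum else (w.take (j - 1)).sum + v := by
  induction w generalizing i j with
  | nil =>
    obtain rfl : i = 0 := by simpa using hi
    rcases j with _ | j <;> simp
  | cons g w ih =>
    rcases j with _ | j
    · simp
    rcases i with _ | i
    · simp [add_comm]
    · have := ih i j (by simpa using hi)
      simp only [List.insertIdx_succ_cons, List.take_succ_cons, List.sum_cons, this,
        Nat.succ_le_succ_iff]
      split_ifs with h
      · rfl
      · obtain ⟨j, rfl⟩ : ∃ j', j = j' + 1 := ⟨j - 1, by omega⟩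
        simp [add_assoc]

end BarChain

/-! ### Realization of bar chains as singular chains of the torus -/

variable {n : ℕ}

theorem intVec_add (v w : Fin n → ℤ) : intVec (v + w) = intVec v + intVec w := by
  ext i; simp [intVec]

theorem torusMk_add (x y : Fin n → ℝ) : torusMk n (x + y) = torusMk n x + torusMk n y := by
  ext i; simp [torusMk]

theorem torusMk_intVec (v : Fin n → ℤ) : torusMk n (intVec v) = 0 := by
  funext i
  have : ((v i : ℝ) : UnitAddCircle) = 0 :=
    (AddCircle.coe_eq_zero_iff 1).2 ⟨v i, by simp⟩
  exact this

/-- Barycentric coordinates sum to `1`, so the simplex moves by a lattice vector. This is needed for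
the zeroth face of a word simplex, which starts at the first letter rather than at the origin. -/
theorem torusSimplex_add_intVec {k : ℕ} (p : Fin (k + 1) → Fin n → ℝ) (v : Fin n → ℤ) :
    torusSimplex (fun j => p j + intVec v) = torusSimplex p := by
  refine ContinuousMap.ext fun s => ?_
  have : straightSimplex (fun j => p j + intVec v) s = straightSimplex p s + intVec v := by
    have h : ∑ j, (s : Fin (k + 1) → ℝ) j = 1 := s.2.2
    simp only [straightSimplex, ContinuousMap.coe_mk, smul_add, Finset.sum_add_distrib,
      ← Finset.sum_smul, h, one_smul]
  simp only [torusSimplex, ContinuousMap.comp_apply, this, torusMk_add, torusMk_intVec, add_zero]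

theorem torusSimplex_comp_faceMap {k : ℕ} (p : Fin (k + 2) → Fin n → ℝ) (i : Fin (k + 2)) :
    (torusSimplex p).comp (faceMap k i) = torusSimplex (p ∘ i.succAbove) := by
  refine ContinuousMap.ext fun s => ?_
  simp only [torusSimplex, ContinuousMap.comp_apply]
  congr 1
  simp only [straightSimplex, faceMap, ContinuousMap.coe_mk, Function.comp_apply,
    stdSimplex.map_coe]
  simp only [FunOnFinite.linearMap_apply_apply, Finset.sum_smul]
  rw [← Finset.sum_fiberwise Finset.univ i.succAbove]
  refine Finset.sum_congr rfl fun j _ => Finset.sum_congr rfl fun l hl => ?_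
  rw [(Finset.mem_filter.1 hl).2]

/-- The singular simplex of the torus whose vertices are the partial sums of a word. -/
def wordSimplex (k : ℕ) (w : List (Fin n → ℤ)) : C(Simplex k, UnitAddTorus (Fin n)) :=
  torusSimplex fun j => intVec (w.take j).sum

/-- The realization of bar chains by singular chains. -/
def realize (n k : ℕ) : BarChain (Fin n → ℤ) →ₗ[ℤ] SingularChain (UnitAddTorus (Fin n)) k :=
  Finsupp.lmapDomain ℤ ℤ (wordSimplex k)

theorem realize_single (k : ℕ) (w : List (Fin n → ℤ)) (a : ℤ) :
    realize n k (Finsupp.single w a) = Finsupp.single (wordSimplex k w) a := by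
  simp [realize]

theorem l1Norm_realize_le (k : ℕ) (x : BarChain (Fin n → ℤ)) :
    l1Norm (realize n k x) ≤ l1 x := by
  have : l1 (realize n k x) ≤ 1 * l1 x := l1_map_le (realize n k) (s := Set.univ) (N := 1) (c := x)
    (fun w _ => by simp [realize_single, l1_single]) (by simp)
  rwa [one_mul] at this

/-- Face `0` removes the first letter, up to a lattice translation; face `i + 1` is `mergeAt i`. -/
theorem boundary_realize {k : ℕ} {x : BarChain (Fin n → ℤ)}
    (hx : x ∈ BarChain.homogeneous (Fin n → ℤ) (k + 1)) :
    boundary k (realize n (k + 1) x) = realize n k (BarChain.differential x) := by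
  refine BarChain.eq_on_homogeneous (f := boundary k ∘ₗ realize n (k + 1))
    (f' := realize n k ∘ₗ BarChain.differential) (fun w hw => ?_) hx
  simp only [LinearMap.comp_apply, realize_single, boundary, Finsupp.linearCombination_single,
    one_smul, Fin.sum_univ_succ (n := k + 1), BarChain.differential, LinearMap.add_apply, map_add]
  congr 1
  · obtain ⟨g, w, rfl⟩ : ∃ g u, w = g :: u := List.exists_cons_of_length_eq_add_one hw
    rw [← BarChain.cons_single, BarChain.tail_cons, realize_single, wordSimplex,
      torusSimplex_comp_faceMap, wordSimplex,
      ← torusSimplex_add_intVec (fun j : Fin (k + 1) => intVec (w.take j).sum) g]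
    simp [Function.comp_def, intVec_add, add_comm]
  · rw [BarChain.inner_single, BarChain.innerWord_eq_sum, map_sum, hw, Finset.sum_range]
    refine Finset.sum_congr rfl fun i _ => ?_
    rw [realize_single, wordSimplex, torusSimplex_comp_faceMap, wordSimplex, Fin.val_succ]
    congr 2
    funext j
    rw [BarChain.sum_take_mergeAt w i j (by omega), Function.comp_apply, Fin.succAbove]
    rcases Nat.lt_or_ge i j with h | h
    · have h' : ¬j.castSucc < i.succ := by
        rw [Fin.lt_def, Fin.val_succ, Fin.val_castSucc]; omega
      simp [h.not_ge, h']
    · have h' : j.castSucc < i.succ := by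
        rw [Fin.lt_def, Fin.val_succ, Fin.val_castSucc]; omega
      simp [h, h']

theorem translationHomotopy_comp_prismSimplex {k : ℕ} (p : Fin (k + 1) → Fin n → ℝ)
    (v : Fin n → ℤ) (i : Fin (k + 1)) :
    ((translationHomotopy v).comp ((torusSimplex p).prodMap (ContinuousMap.id unitInterval))).comp
      (prismSimplex k i) = torusSimplex fun j : Fin (k + 2) =>
        if h : (j : ℕ) ≤ k - i then p ⟨j, by omega⟩ else p ⟨j - 1, by omega⟩ + intVec v := by
  refine ContinuousMap.ext fun s => ?_
  simp only [ContinuousMap.comp_apply, ContinuousMap.prodMap_apply, Prod.map, torusSimplex,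
    translationHomotopy_mk, ContinuousMap.id_apply]
  congr 1
  change ∑ l, (∑ j, (s : Fin (k + 2) → ℝ) j • prismVertex k i j).1 l • p l +
    (∑ j, (s : Fin (k + 2) → ℝ) j • prismVertex k i j).2 • intVec v =
    ∑ j, (s : Fin (k + 2) → ℝ) j • _
  simp only [Prod.fst_sum, Prod.snd_sum,
    Finset.sum_apply, Prod.smul_fst, Prod.smul_snd, Pi.smul_apply, Finset.sum_smul]
  rw [Finset.sum_comm, ← Finset.sum_add_distrib]
  refine Finset.sum_congr rfl fun j _ => ?_
  unfold prismVertex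
  split_ifs with h
  · simp [Pi.single_apply, ite_smul]
  · simp [Pi.single_apply, ite_smul]

theorem prismOperator_realize (v : Fin n → ℤ) {k : ℕ} {x : BarChain (Fin n → ℤ)}
    (hx : x ∈ BarChain.homogeneous (Fin n → ℤ) k) :
    prismOperator (translationHomotopy v) k (realize n k x) =
      realize n (k + 1) (BarChain.insert v x) := by
  refine BarChain.eq_on_homogeneous (f := prismOperator (translationHomotopy v) k ∘ₗ realize n k)
    (f' := realize n (k + 1) ∘ₗ BarChain.insert v) (fun w hw => ?_) hx
  simp only [LinearMap.comp_apply, realize_single, prismOperator, pushforward, prismChain,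
    Finsupp.linearCombination_single, one_smul, map_sum, BarChain.insert_single,
    BarChain.insertWord_eq_sum, Finset.sum_range, hw]
  refine Finset.sum_congr rfl fun i _ => ?_
  rw [Finsupp.smul_single_one, wordSimplex, translationHomotopy_comp_prismSimplex, wordSimplex]
  congr 2
  funext j
  rw [BarChain.sum_take_insertIdx _ _ _ _ (by omega)]
  split_ifs <;> simp [intVec_add]

/-- Degree `1` is checked by hand, because `[0, v₁]` is not defined through the prism operator. -/
theorem parallelogram_eq_realize (k : ℕ) (v : Fin k → Fin n → ℤ) :
    parallelogram k v = realize n k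
      (BarChain.iterInsert _ k (fun i => Finsupp.single (v i) 1) (Finsupp.single [] 1)) := by
  have h0 : Finsupp.single [] 1 ∈ BarChain.homogeneous (Fin n → ℤ) 0 :=
    BarChain.single_mem_homogeneous rfl 1
  induction k with
  | zero =>
    rw [BarChain.iterInsert_zero, Module.End.one_apply, realize_single, parallelogram, wordSimplex]
    congr 2
    funext j i
    fin_cases j
    simp [intVec]
  | succ k ih =>
    rw [BarChain.iterInsert_succ_last_single]
    rcases k with _ | k
    · rw [BarChain.iterInsert_zero, Module.End.one_apply, BarChain.insert_nil,
        BarChain.cons_single, realize_single, parallelogram, wordSimplex]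
      congr 2
      funext j i
      fin_cases j <;> simp [intVec]
    · have h := BarChain.iterInsert_mem (Fin.init v) h0
      rw [zero_add] at h
      rw [parallelogram, ih, prismOperator_realize _ h]

/-! ### Chains that differ by a boundary with a short filling -/

section Near

variable {X : Type*} [TopologicalSpace X] {k : ℕ}

/-- The difference of two chains has a filling of norm at most `m`. -/
def Near (m : ℕ) (c d : SingularChain X k) : Prop :=
  ∃ z : SingularChain X (k + 1), boundary k z = c - d ∧ l1Norm z ≤ m

namespace Near

variable {m m' : ℕ} {a b c d : SingularChain X k}

theorem mono (h : Near m a b) (hm : m ≤ m') : Near m' a b :=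
  let ⟨z, hz, hz'⟩ := h
  ⟨z, hz, hz'.trans hm⟩

theorem of_eq (h : a = b) : Near m a b :=
  ⟨0, by simp [h], Nat.zero_le m⟩

theorem congr_sub (h : Near m a b) (e : a - b = c - d) : Near m c d := by
  rwa [Near, ← e]

theorem add (h : Near m a b) (h' : Near m' c d) : Near (m + m') (a + c) (b + d) := by
  obtain ⟨z, hz, hm⟩ := h
  obtain ⟨z', hz', hm'⟩ := h'
  refine ⟨z + z', ?_, (l1_add_le z z').trans (Nat.add_le_add hm hm')⟩
  rw [map_add, hz, hz']
  abel

theorem trans (h : Near m a b) (h' : Near m' b c) : Near (m + m') a c :=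
  (h.add h').congr_sub (by abel)

theorem neg (h : Near m a b) : Near m (-a) (-b) := by
  obtain ⟨z, hz, hm⟩ := h
  refine ⟨-z, ?_, (l1_neg z).trans_le hm⟩
  rw [map_neg, hz]
  abel

theorem symm (h : Near m a b) : Near m b a :=
  h.neg.congr_sub (by abel)

theorem add_left (a : SingularChain X k) (h : Near m b c) : Near m (a + b) (a + c) :=
  h.congr_sub (by abel)

theorem units_smul (u : ℤˣ) (h : Near m a b) : Near m (u • a) (u • b) := by
  rcases Int.units_eq_one_or u with rfl | rfl
  · simpa using h
  · simpa using h.neg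

theorem sum {ι : Type*} {s : Finset ι} {f g : ι → SingularChain X k}
    (h : ∀ i ∈ s, Near m (f i) (g i)) : Near (s.card * m) (∑ i ∈ s, f i) (∑ i ∈ s, g i) := by
  classical
  induction s using Finset.induction_on with
  | empty => exact of_eq rfl
  | insert i s hi ih =>
    rw [Finset.sum_insert hi, Finset.sum_insert hi, Finset.card_insert_of_notMem hi]
    refine ((h i (Finset.mem_insert_self i s)).add
      (ih fun j hj => h j (Finset.mem_insert_of_mem hj))).mono (le_of_eq ?_)
    ring

end Near

/-! ### Quasi-additive and quasi-biadditive maps -/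

variable {G : Type*} [AddCommGroup G] {C : ℕ}

/-- A map to chains that is additive up to boundaries with fillings of norm at most `C`. -/
def QuasiAdditive (C : ℕ) (f : G → SingularChain X k) : Prop :=
  ∀ x y, Near C (f (x + y)) (f x + f y)

namespace QuasiAdditive

variable {f : G → SingularChain X k}

theorem zero (hf : QuasiAdditive C f) : Near C (f 0) 0 :=
  (hf 0 0).symm.congr_sub (by rw [add_zero]; abel)

theorem neg (hf : QuasiAdditive C f) (x : G) : Near (2 * C) (f (-x)) (-f x) := by
  have h := (hf x (-x)).symm.trans ((add_neg_cancel x).symm ▸ hf.zero)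
  exact (h.congr_sub (by abel)).mono (by omega)

theorem units_smul (hf : QuasiAdditive C f) (u : ℤˣ) (x : G) :
    Near (2 * C) (u • f x) (f (u • x)) := by
  rcases Int.units_eq_one_or u with rfl | rfl
  · exact Near.of_eq (by simp)
  · simpa using (hf.neg x).symm

theorem sum (hf : QuasiAdditive C f) {ι : Type*} (s : Finset ι) (x : ι → G) :
    Near ((s.card + 1) * C) (f (∑ i ∈ s, x i)) (∑ i ∈ s, f (x i)) := by
  classical
  induction s using Finset.induction_on with
  | empty => simpa using hf.zero
  | insert i s hi ih =>
    rw [Finset.sum_insert hi, Finset.sum_insert hi, Finset.card_insert_of_notMem hi]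
    refine ((hf _ _).trans (ih.add_left _)).mono (le_of_eq ?_)
    ring

end QuasiAdditive

/-- A map to chains that is biadditive up to boundaries with fillings of norm at most `C`. -/
structure QuasiBiadditive (C : ℕ) (B : G → G → SingularChain X k) : Prop where
  left : ∀ y, QuasiAdditive C fun x => B x y
  right : ∀ x, QuasiAdditive C (B x)

namespace QuasiBiadditive

variable {B : G → G → SingularChain X k}

/-- Induction on binary digits: with `a = 2 b + e`, one doubling is passed from `x` to `y` through
`B (x + x) (b • y) ≈ B x (b • y + b • y)`. Each digit costs `6 * C`: four uses of additivity and at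
most `2 * C` for the digit `e`. -/
theorem nsmul (hB : QuasiBiadditive C B) (l : ℕ) : ∀ a < 2 ^ l, ∀ x y,
    Near ((6 * l + 2) * C) (B (a • x) y) (B x (a • y)) := by
  induction l with
  | zero =>
    intro a ha x y
    obtain rfl : a = 0 := by simpa using ha
    have h := (hB.left y).zero.trans (hB.right x).zero.symm
    simp only [zero_smul]
    exact h.mono (by omega)
  | succ l ih =>
    intro a ha x y
    obtain ⟨b, e, he, hb, rfl⟩ : ∃ b e, e < 2 ∧ b < 2 ^ l ∧ a = b * 2 + e :=
      ⟨a / 2, a % 2, Nat.mod_lt _ (by omega), by rw [pow_succ] at ha; omega, by omega⟩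
    have hx : (b * 2 + e) • x = b • (x + x) + e • x := by
      rw [add_smul, mul_smul, two_smul]
    have hy : (b * 2 + e) • y = (b • y + b • y) + e • y := by
      rw [add_smul, mul_comm, mul_smul, two_smul]
    have h_digit : Near (2 * C) (B (e • x) y) (B x (e • y)) := by
      interval_cases e
      · have h := (hB.left y).zero.trans (hB.right x).zero.symm
        simp only [zero_smul]
        exact h.mono (by omega)
      · exact Near.of_eq (by simp)
    have h_double : Near (2 * C) (B (x + x) (b • y)) (B x (b • y + b • y)) :=
      ((hB.left _ x x).trans (hB.right x _ _).symm).mono (by omega)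
    rw [hx, hy]
    refine ((hB.left y _ _).trans ((((ih b hb (x + x) y).trans h_double).add h_digit).trans
      (hB.right x _ _).symm)).mono (le_of_eq ?_)
    ring

theorem zsmul (hB : QuasiBiadditive C B) {l : ℕ} {a : ℤ} (ha : a.natAbs < 2 ^ l) (x y : G) :
    Near ((6 * l + 6) * C) (B (a • x) y) (B x (a • y)) := by
  have h := hB.nsmul l _ ha x y
  rcases Int.natAbs_eq a with e | e
  · rw [e, natCast_zsmul, natCast_zsmul]
    exact h.mono (Nat.mul_le_mul_right _ (by omega))
  · rw [e, neg_smul, neg_smul, natCast_zsmul, natCast_zsmul]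
    refine (((hB.left y).neg _).trans (h.neg.trans ((hB.right x).neg _).symm)).mono (le_of_eq ?_)
    ring

/-- Moving `a` across and using antisymmetry would only give `2 B (a • x) x ≈ 0`, and integral
chains do not allow division by `2`. So `a` is halved first: one of the two copies of `B (b • x) x`
becomes `B x (b • x)`, and their sum is small by polarization. -/
theorem zsmul_self (hB : QuasiBiadditive C B) (hB0 : ∀ x, B x x = 0) {l : ℕ} {a : ℤ}
    (ha : a.natAbs < 2 ^ l) (x : G) : Near ((6 * l + 12) * C) (B (a • x) x) 0 := by
  obtain ⟨b, e, he, hb, rfl⟩ :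
      ∃ b e : ℤ, (e = 0 ∨ e = 1) ∧ b.natAbs < 2 ^ l ∧ a = b + b + e :=
    ⟨a / 2, a % 2, Int.emod_two_eq_zero_or_one a, by omega, by omega⟩
  have h_digit : Near C (B (e • x) x) 0 := by
    rcases he with rfl | rfl
    · simpa using (hB.left x).zero
    · exact Near.of_eq (by simp [hB0])
  -- Polarization: expand `B (b • x + x) (b • x + x) = 0` and drop the diagonal terms.
  have h_alt : Near (3 * C) (B (b • x) x + B x (b • x)) 0 := by
    have h1 : Near C (B (b • x) (b • x + x) + B x (b • x + x)) (B (b • x + x) (b • x + x)) :=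
      (hB.left (b • x + x) (b • x) x).symm
    rw [hB0] at h1
    have h2 := (hB.right (b • x) (b • x) x).symm
    rw [hB0, zero_add] at h2
    have h3 := (hB.right x (b • x) x).symm
    rw [hB0, add_zero] at h3
    exact ((h2.add h3).trans h1).mono (by omega)
  rw [add_smul, add_smul]
  have h := (hB.left x (b • x + b • x) (e • x)).trans (((hB.left x (b • x) (b • x)).trans
    (((hB.zsmul hb x x).add_left (B (b • x) x)).trans h_alt)).add h_digit)
  rw [add_zero] at h
  exact h.mono (le_of_eq (by ring))

end QuasiBiadditive

/-! ### Quasi-multiadditive maps -/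

open Function (update)

/-- A map of `n` variables that is additive in each variable, up to boundaries with fillings of
norm at most `C`. -/
def QuasiMultiadditive (C : ℕ) {n : ℕ} (P : (Fin n → G) → SingularChain X k) : Prop :=
  ∀ v i, QuasiAdditive C fun x => P (update v i x)

namespace QuasiMultiadditive

variable {n : ℕ} {P : (Fin n → G) → SingularChain X k}

/-- Expand the first variable, then the others with the first one frozen. Freezing changes the map,
so the bound has to be uniform in `P`. -/
theorem exists_near_sum (C : ℕ) (ι : Type*) [Fintype ι] (n : ℕ) :
    ∃ N : ℕ, ∀ P : (Fin n → G) → SingularChain X k, QuasiMultiadditive C P →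
      ∀ x : Fin n → ι → G,
        Near N (P fun i => ∑ j, x i j) (∑ r : Fin n → ι, P fun i => x i (r i)) := by
  induction n with
  | zero =>
    refine ⟨0, fun P _ x => Near.of_eq ?_⟩
    rw [Fintype.sum_unique]
    congr 1
    exact Subsingleton.elim _ _
  | succ n ih =>
    obtain ⟨N, hN⟩ := ih
    refine ⟨(Fintype.card ι + 1) * C + Fintype.card ι * N, fun P hP x => ?_⟩
    have hcons (y : G) : QuasiMultiadditive C fun v : Fin n → G => P (Fin.cons y v) := by
      intro v i
      simpa only [Fin.cons_update] using hP (Fin.cons y v) i.succ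
    have h1 := (hP (fun i => ∑ j, x i j) 0).sum Finset.univ (x 0)
    rw [Function.update_eq_self] at h1
    have h2 := Near.sum (s := Finset.univ) fun j _ => hN _ (hcons (x 0 j)) (Fin.tail x)
    have e1 (y : G) : update (fun i => ∑ j, x i j) 0 y =
        Fin.cons y fun i => ∑ j, Fin.tail x i j := by
      rw [← Fin.cons_self_tail (fun i => ∑ j, x i j), Fin.update_cons_zero]
      rfl
    simp only [e1] at h1
    have e2 : ∑ r : Fin (n + 1) → ι, P (fun i => x i (r i)) =
        ∑ j, ∑ r : Fin n → ι, P (Fin.cons (x 0 j) fun i => Fin.tail x i (r i)) := by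
      rw [← Fintype.sum_prod_type', ← (Fin.consEquiv fun _ => ι).sum_comp]
      refine Finset.sum_congr rfl fun q _ => congrArg P (funext fun i => ?_)
      refine Fin.cases ?_ (fun i => ?_) i <;> simp [Fin.consEquiv, Fin.tail]
    rw [e2]
    exact h1.trans h2

theorem quasiBiadditive (hP : QuasiMultiadditive C P) (v : Fin n → G) {i j : Fin n}
    (hij : i ≠ j) : QuasiBiadditive C fun x y => P (update (update v i x) j y) where
  left y := by
    simpa only [Function.update_comm hij] using hP (update v j y) i
  right x := hP (update v i x) j

theorem near_prod_smul (hP : QuasiMultiadditive C P) {l : ℕ} {a : Fin n → ℤ}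
    (ha : ∀ j, (a j).natAbs < 2 ^ l) (x : Fin n → G) (i : Fin n) :
    Near (n * ((6 * l + 6) * C)) (P fun j => a j • x j)
      (P (update x i ((∏ j, a j) • x i))) := by
  -- `S` is the set of slots still carrying their scalar and `b` is the product already collected in
  -- slot `i`. Each move carries a single `a j` across, so the cost does not depend on the size of
  -- `b`.
  have key (S : Finset (Fin n)) (hi : i ∉ S) (b : ℤ) :
      Near (S.card * ((6 * l + 6) * C))
        (P (update (fun j => if j ∈ S then a j • x j else x j) i (b • x i)))
        (P (update x i ((b * ∏ j ∈ S, a j) • x i))) := by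
    induction S using Finset.induction_on generalizing b with
    | empty => exact Near.of_eq (by simp)
    | insert j S hj ih =>
      have hij : i ≠ j := fun h => hi (h ▸ Finset.mem_insert_self j S)
      have hB := (hP.quasiBiadditive (fun m => if m ∈ S then a m • x m else x m) hij).zsmul
        (ha j) (b • x i) (x j)
      have e' : update (update (fun m => if m ∈ S then a m • x m else x m) i (a j • b • x i)) j
          (x j) = update (fun m => if m ∈ S then a m • x m else x m) i ((a j * b) • x i) := by
        rw [smul_smul]
        funext m
        rcases eq_or_ne m j with rfl | hm
        · simp [hij.symm, hj]
        · simp [hm]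
      rw [e'] at hB
      have h := hB.symm.trans (ih (fun h => hi (Finset.mem_insert_of_mem h)) (a j * b))
      rw [Finset.prod_insert hj, Finset.card_insert_of_notMem hj, ← mul_assoc b, mul_comm b]
      have e : update (fun m => if m ∈ insert j S then a m • x m else x m) i (b • x i) =
          update (update (fun m => if m ∈ S then a m • x m else x m) i (b • x i)) j
            (a j • x j) := by
        funext m
        rcases eq_or_ne m j with rfl | hm
        · simp [hij.symm]
        · rcases eq_or_ne m i with rfl | hm'
          · simp [hm]
          · simp [hm, hm']
      rw [e]
      refine h.mono (le_of_eq ?_)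
      ring
  have h := key (Finset.univ.erase i) (Finset.notMem_erase i _) (a i)
  rw [Finset.mul_prod_erase _ _ (Finset.mem_univ i)] at h
  have e : update (fun j => if j ∈ Finset.univ.erase i then a j • x j else x j) i (a i • x i) =
      fun j => a j • x j := by
    funext j
    rcases eq_or_ne j i with rfl | hj <;> simp [*]
  rw [e] at h
  exact h.mono (Nat.mul_le_mul_right _ (by simp))

theorem near_zero (hP : QuasiMultiadditive C P)
    (h0 : ∀ (v : Fin n → G) i j, v i = v j → i ≠ j → P v = 0) {l : ℕ} {a : ℤ}
    (ha : a.natAbs < 2 ^ l) (x : Fin n → G) {i j : Fin n} (hij : i ≠ j) (hx : x i = x j) :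
    Near ((6 * l + 12) * C) (P (update x i (a • x i))) 0 := by
  have h := (hP.quasiBiadditive x hij).zsmul_self
    (fun y => h0 _ i j (by simp [hij]) hij) ha (x i)
  rwa [hx, Function.update_comm hij, Function.update_eq_self, ← hx] at h

theorem exists_near_det (hP : QuasiMultiadditive C P)
    (h0 : ∀ (v : Fin n → G) i j, v i = v j → i ≠ j → P v = 0)
    (hperm : ∀ (v : Fin n → G) (σ : Equiv.Perm (Fin n)), P (v ∘ σ) = σ.sign • P v)
    (e : Fin n → G) (i₀ : Fin n) :
    ∃ N : ℕ, ∀ (l : ℕ) (A : Matrix (Fin n) (Fin n) ℤ), (∀ i j, (A i j).natAbs < 2 ^ l) →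
      Near (N * l + N) (P fun i => ∑ j, A j i • e j) (P (update e i₀ (A.det • e i₀))) := by
  obtain ⟨N, hN⟩ := exists_near_sum (X := X) (k := k) (G := G) C (Fin n) n
  -- The right-hand side has at most one nonzero summand, and none when `r` is not a permutation. In
  -- this form, summing over `r` and exchanging the sums leaves a sum over permutations.
  have hterm (l : ℕ) (A : Matrix (Fin n) (Fin n) ℤ) (hA : ∀ i j, (A i j).natAbs < 2 ^ l)
      (r : Fin n → Fin n) : Near ((12 * n * l + 6 * n + 18) * C) (P fun i => A (r i) i • e (r i))
      (∑ σ : Equiv.Perm (Fin n), if ⇑σ = r then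
        σ.sign • P (update e i₀ ((∏ i, A (σ i) i) • e i₀)) else 0) := by
    by_cases hr : Function.Injective r
    · obtain ⟨σ, rfl⟩ : ∃ σ : Equiv.Perm (Fin n), ⇑σ = r :=
        ⟨Equiv.ofBijective r (Finite.injective_iff_bijective.1 hr), rfl⟩
      simp only [DFunLike.coe_fn_eq, Finset.sum_ite_eq', Finset.mem_univ, if_true]
      rw [← hperm, Function.update_comp_equiv]
      -- Slot `σ.symm i₀` is the one holding `e i₀`, so all permutations collect their scalar on the
      -- same vector.
      have h := hP.near_prod_smul (fun i => hA (σ i) i) (e ∘ σ) (σ.symm i₀)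
      simp only [Function.comp_apply, Equiv.apply_symm_apply] at h
      exact h.mono (by nlinarith [Nat.zero_le (n * l * C)])
    · rw [Finset.sum_eq_zero fun σ _ => if_neg fun h => hr (by rw [← h]; exact σ.injective)]
      simp only [Function.Injective, not_forall] at hr
      obtain ⟨i, j, hij, hne⟩ := hr
      have h := hP.near_prod_smul (fun i => hA (r i) i) (e ∘ r) i
      -- The product of all `n` scalars has at most about `n * l` binary digits, so killing this
      -- term still costs `O(l)`.
      have hprod : (∏ i, A (r i) i).natAbs < 2 ^ (n * l + 1) := by
        rw [pow_succ, show (∏ i, A (r i) i).natAbs = ∏ i, (A (r i) i).natAbs from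
          map_prod Int.natAbsHom _ _]
        refine (Finset.prod_le_prod' fun i _ => (hA (r i) i).le).trans_lt ?_
        rw [Finset.prod_const, Finset.card_univ, Fintype.card_fin, ← pow_mul, mul_comm l]
        exact lt_mul_of_one_lt_right (by positivity) one_lt_two
      exact (h.trans (hP.near_zero h0 hprod (e ∘ r) hne (congrArg e hij))).mono
        (le_of_eq (by ring))
  -- Only the `i₀` slot varies now, and a sum of `n!` terms is reassembled there at a cost free of
  -- `l`.
  have hdet (A : Matrix (Fin n) (Fin n) ℤ) :
      Near (n.factorial * (2 * C) + (n.factorial + 1) * C)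
        (∑ σ : Equiv.Perm (Fin n), σ.sign • P (update e i₀ ((∏ i, A (σ i) i) • e i₀)))
        (P (update e i₀ (A.det • e i₀))) := by
    have hf := hP e i₀
    have h1 := Near.sum (s := Finset.univ) fun (σ : Equiv.Perm (Fin n)) _ =>
      hf.units_smul σ.sign ((∏ i, A (σ i) i) • e i₀)
    have h2 := (hf.sum Finset.univ fun σ : Equiv.Perm (Fin n) =>
      σ.sign • ((∏ i, A (σ i) i) • e i₀)).symm
    rw [Finset.card_univ, Fintype.card_perm, Fintype.card_fin] at h1 h2
    have e1 : A.det • e i₀ = ∑ σ : Equiv.Perm (Fin n), σ.sign • ((∏ i, A (σ i) i) • e i₀) := by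
      simp only [Matrix.det_apply, Finset.sum_smul, Units.smul_def, smul_assoc]
    rw [e1]
    exact h1.trans h2
  set D := n.factorial * (2 * C) + (n.factorial + 1) * C
  set M := Fintype.card (Fin n → Fin n)
  refine ⟨N + M * (12 * n + 6 * n + 18) * C + D, fun l A hA => ?_⟩
  have h1 := hN P hP fun i j => A j i • e j
  have h2 := Near.sum (s := Finset.univ) fun r _ => hterm l A hA r
  rw [Finset.sum_comm] at h2
  simp only [Finset.sum_ite_eq, Finset.mem_univ, if_true, Finset.card_univ] at h2
  refine ((h1.trans h2).trans (hdet A)).mono ?_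
  have : M * ((12 * n * l + 6 * n + 18) * C) ≤ M * (12 * n + 6 * n + 18) * C * (l + 1) := by
    calc M * ((12 * n * l + 6 * n + 18) * C)
        ≤ M * ((12 * n + 6 * n + 18) * (l + 1) * C) :=
          Nat.mul_le_mul_left _ (Nat.mul_le_mul_right _ (by nlinarith))
      _ = M * (12 * n + 6 * n + 18) * C * (l + 1) := by ring
  nlinarith [Nat.zero_le (N * l), Nat.zero_le (D * l)]

end QuasiMultiadditive

end Near

/-! ### Parallelogram-like cycles -/

theorem fillingNorm_le {X : Type*} [TopologicalSpace X] {k m : ℕ} {c d : SingularChain X k}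
    (h : Near m c d) : fillingNorm (c - d) ≤ m :=
  let ⟨z, hz, hm⟩ := h
  le_trans (Nat.sInf_le ⟨z, hz, rfl⟩) hm

theorem Near.sub_mem_boundaries {X : Type*} [TopologicalSpace X] {k m : ℕ}
    {c d : SingularChain X k} (h : Near m c d) : c - d ∈ boundaries X k :=
  let ⟨z, hz, _⟩ := h
  ⟨z, hz⟩

variable {n k : ℕ}

theorem parallelogram_comp_perm (v : Fin k → Fin n → ℤ) (σ : Equiv.Perm (Fin k)) :
    parallelogram k (v ∘ σ) = σ.sign • parallelogram k v := by
  rw [parallelogram_eq_realize, parallelogram_eq_realize]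
  have h := (BarChain.iterInsert (Fin n → ℤ) k).map_perm (fun i => Finsupp.single (v i) 1) σ
  rw [show (fun i => Finsupp.single ((v ∘ σ) i) (1 : ℤ)) =
    (fun i => Finsupp.single (v i) (1 : ℤ)) ∘ σ from rfl, h]
  simp only [Units.smul_def, LinearMap.smul_apply, map_smul]

theorem parallelogram_eq_zero (v : Fin k → Fin n → ℤ) (i j : Fin k) (h : v i = v j)
    (hij : i ≠ j) : parallelogram k v = 0 := by
  rw [parallelogram_eq_realize, AlternatingMap.map_eq_zero_of_eq _ _ (by rw [h]) hij]
  simp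

/-- The filling is the iterated insertion of `v` into `[x, y]`. Its boundary is the insertion into
`[y] - [x + y] + [x]`, since insertions commute with the differential. -/
theorem quasiAdditive_parallelogram_cons (v : Fin k → Fin n → ℤ) :
    QuasiAdditive (k + 2).factorial fun x => parallelogram (k + 1) (Fin.cons x v) := by
  intro x y
  have hpair : Finsupp.single [x, y] 1 ∈ BarChain.homogeneous (Fin n → ℤ) 2 :=
    BarChain.single_mem_homogeneous rfl 1
  have hmem := BarChain.iterInsert_mem v hpair
  have hnorm := BarChain.l1_iterInsert_le v hpair
  rw [add_comm 2 k] at hmem hnorm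
  have hpar (u : Fin n → ℤ) : parallelogram (k + 1) (Fin.cons u v) = realize n (k + 1)
      (BarChain.iterInsert _ k (fun i => Finsupp.single (v i) 1) (Finsupp.single [u] 1)) := by
    rw [parallelogram_eq_realize, BarChain.iterInsert_succ]
    simp [BarChain.insert_nil, Fin.tail_def]
  refine Near.symm ⟨_, ?_, (l1Norm_realize_le (k + 2) _).trans (hnorm.trans (by simp [l1_single]))⟩
  rw [boundary_realize hmem, BarChain.differential_iterInsert, BarChain.differential_pair]
  simp only [hpar, map_add, map_sub]
  abel

theorem quasiMultiadditive_parallelogram (n k : ℕ) :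
    QuasiMultiadditive (k + 2).factorial
      (parallelogram (k + 1) : (Fin (k + 1) → Fin n → ℤ) → _) := by
  intro v i x y
  -- Exact alternation brings slot `i` to the front, at the price of a sign.
  have h (u : Fin n → ℤ) : parallelogram (k + 1) (Function.update v i u) =
      (Equiv.swap 0 i).sign • parallelogram (k + 1)
        (Fin.cons u (Fin.tail (v ∘ Equiv.swap 0 i))) := by
    rw [← parallelogram_comp_perm]
    congr 1
    rw [← Fin.update_cons_zero ((v ∘ Equiv.swap 0 i) 0), Fin.cons_self_tail,
      Function.update_comp_equiv, Function.comp_assoc]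
    simp [← Equiv.coe_trans]
  simp only [h, ← smul_add]
  exact (quasiAdditive_parallelogram_cons _ x y).units_smul _

theorem exists_near_rectangle (n : ℕ) (hn : 0 < n) :
    ∃ N : ℕ, ∀ (l : ℕ) (A : Matrix (Fin n) (Fin n) ℤ), (∀ i j, (A i j).natAbs < 2 ^ l) →
      Near (N * l + N) (parallelogram n fun i j => A j i)
        (rectangle fun i : Fin n => if (i : ℕ) = 0 then A.det else 1) := by
  obtain ⟨m, rfl⟩ : ∃ m, n = m + 1 := ⟨n - 1, by omega⟩
  obtain ⟨N, hN⟩ := (quasiMultiadditive_parallelogram (m + 1) m).exists_near_det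
    parallelogram_eq_zero parallelogram_comp_perm (fun i => Pi.single i 1) 0
  refine ⟨N, fun l A hA => ?_⟩
  have e1 : (fun i => ∑ j, A j i • (Pi.single j 1 : Fin (m + 1) → ℤ)) = fun i j => A j i := by
    funext i j
    simp [Finset.sum_apply, Pi.single_apply]
  have e2 : Function.update (fun i => (Pi.single i 1 : Fin (m + 1) → ℤ)) 0
      (A.det • Pi.single 0 1) = fun i : Fin (m + 1) => Pi.single i (if (i : ℕ) = 0 then A.det else 1) := by
    funext i
    rcases eq_or_ne i 0 with rfl | hi
    · funext j
      simp [Pi.single_apply]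
    · have : (i : ℕ) ≠ 0 := fun h => hi (Fin.ext h)
      simp [hi]
  have h := hN l A hA
  rwa [e1, e2] at h

/-! ### Entry size and binary length -/

theorem natAbs_le_norm {m n : ℕ} (A : Matrix (Fin m) (Fin n) ℤ) (i : Fin m) (j : Fin n) :
    ((A i j).natAbs : ℝ) ≤ ‖A‖ := by
  have h := Matrix.norm_entry_le_entrywise_sup_norm A (i := i) (j := j)
  rwa [Int.norm_eq_abs, ← Int.cast_abs, Int.abs_eq_natAbs, Int.cast_natCast] at h

theorem natAbs_lt_two_pow {m n : ℕ} (A : Matrix (Fin m) (Fin n) ℤ) (i : Fin m) (j : Fin n) :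
    (A i j).natAbs < 2 ^ (Nat.log 2 ⌊‖A‖⌋₊ + 1) := by
  exact lt_of_le_of_lt (Nat.le_floor (natAbs_le_norm A i j))
    (Nat.lt_pow_succ_log_self one_lt_two _)

theorem natLog_floor_norm_le {m n : ℕ} (A : Matrix (Fin m) (Fin n) ℤ) :
    (Nat.log 2 ⌊‖A‖⌋₊ : ℝ) ≤ Real.logb 2 ‖A‖ := by
  -- An integral matrix of norm below `1` is zero, and then both logarithms take the default value
  -- `0`.
  rcases lt_or_ge ‖A‖ 1 with h | h
  · have hA : A = 0 := by
      ext i j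
      have : (A i j).natAbs < 1 := by exact_mod_cast (natAbs_le_norm A i j).trans_lt h
      simpa using this
    simp [hA]
  · have h1 : 1 ≤ ⌊‖A‖⌋₊ := (Nat.one_le_floor_iff _).2 h
    refine (Real.natLog_le_logb _ _).trans ?_
    exact Real.logb_le_logb_of_le one_lt_two (by exact_mod_cast h1)
      (Nat.floor_le (norm_nonneg A))

end TorusFilling

end

theorem mainTheorem3 (n : ℕ) (hn : 0 < n) :
    ∃ K : ℝ, 0 < K ∧ ∀ (v : Fin n → Fin n → ℤ) (A : Matrix (Fin n) (Fin n) ℤ),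
      (∀ i j, A i j = v j i) →
        TorusFilling.parallelogram n v -
            TorusFilling.rectangle (fun i : Fin n => if (i : ℕ) = 0 then A.det else 1) ∈
          TorusFilling.boundaries (UnitAddTorus (Fin n)) n ∧
        (TorusFilling.fillingNorm
            (TorusFilling.parallelogram n v -
              TorusFilling.rectangle (fun i : Fin n => if (i : ℕ) = 0 then A.det else 1)) : ℝ) ≤
          K * Real.logb 2 ‖A‖ + K := by
  obtain ⟨N, hN⟩ := TorusFilling.exists_near_rectangle n hn
  -- The digit bound is `l = Nat.log 2 ⌊‖A‖⌋₊ + 1`, so `N * l + N` contributes the constant `2 * N`;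
  -- the additional `1` makes the constant positive.
  refine ⟨2 * N + 1, by positivity, fun v A hA => ?_⟩
  have h := hN _ A (TorusFilling.natAbs_lt_two_pow A)
  rw [show (fun i j => A j i) = v from funext fun i => funext fun j => hA j i] at h
  refine ⟨h.sub_mem_boundaries, (Nat.cast_le.2 (TorusFilling.fillingNorm_le h)).trans ?_⟩
  have hlog := TorusFilling.natLog_floor_norm_le A
  have hlog0 : (0 : ℝ) ≤ Nat.log 2 ⌊‖A‖⌋₊ := Nat.cast_nonneg _
  have hN0 : (0 : ℝ) ≤ N := Nat.cast_nonneg _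
  push_cast
  nlinarith [mul_le_mul_of_nonneg_left hlog hN0, mul_nonneg hN0 (hlog0.trans hlog)]
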